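/- Let $A$ be a commutative noetherian ring of finite Krull dimension $d$ and let $n\geq 0$ be an integer. Let $\mathcal{LO}(A,n)$ be the set of pairs $(I,\omega)$, where $I\subseteq A$ is an ideal and $\omega:A^n\twoheadrightarrow I/I^2$ is a surjective $A$-linear map; $(I,\omega)$ is called global if $\omega$ lifts to a surjective $A$-linear map $A^n\twoheadrightarrow I$. Let $\mathcal{LO}^c(A,n)$ be the set of $(I,\omega)\in\mathcal{LO}(A,n)$ such that $V(I)\subseteq\mathrm{Spec}(A)$ is connected (in particular non-empty) and $\mathrm{height}(I)\geq n$. Let $\mathcal{LO}^c_0(A,n)$ be the set of pairs $(I,[\omega])$ with $(I,\omega)\in\mathcal{LO}^c(A,n)$, where $[\omega]$ is the class of $\omega$ under the equivalence relation $\omega\sim\omega\sigma$, $\sigma\in EL_n(A)$ (the subgroup of $GL_n(A)$ generated by the elementary matrices). For a set $S$ let $\mathbb Z(S)$ be the free abelian group on $S$. For $(I,\omega)\in\mathcal{LO}(A,n)$ with $\mathrm{height}(I)\geq n$ write $I=\bigcap_{i=1}^m I_i$ with the $I_i$ pairwise comaximal and each $V(I_i)$ connected (this decomposition is unique up to order,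 and $m=0$ if $I=A$); composing $\omega$ with the natural maps $I/I^2\to I_i/I_i^2$ gives $(I_i,\omega_i)\in\mathcal{LO}^c(A,n)$. Put $\varepsilon(I,\omega)=\sum_i (I_i,\omega_i)\in\mathbb Z(\mathcal{LO}^c(A,n))$ and $\varepsilon_0(I,\omega)=\sum_i (I_i,[\omega_i])\in\mathbb Z(\mathcal{LO}^c_0(A,n))$. Let $\mathscr R^n(A)$ and $\mathscr R^n_0(A)$ be the subgroups generated by all $\varepsilon(I,\omega)$, respectively all $\varepsilon_0(I,\omega)$, with $(I,\omega)$ global and $\mathrm{height}(I)\geq n$, and define $$E^n(A)=\mathbb Z(\mathcal{LO}^c(A,n))/\mathscr R^n(A),\qquad \mathcal E^n(A)=\mathbb Z(\mathcal{LO}^c_0(A,n))/\mathscr R^n_0(A)$$ (the modified Euler class group and the Euler class group of Bhatwadekar and Sridharan). Then the homomorphism $\varphi:\mathbb Z(\mathcal{LO}^c(A,n))\to\mathbb Z(\mathcal{LO}^c_0(A,n))$, $(I,\omega)\mapsto(I,[\omega])$, induces a surjective group homomorphism $\Phi_n:E^n(A)\twoheadrightarrow\mathcal E^n(A)$. If $2n\geq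 d+3$, then $\Phi_n$ is an isomorphism. -/

import Mathlib

namespace EulerClass

/-- A surjective `A`-linear map `ω : Aⁿ → I/I²`. -/
def Orientation {A : Type*} [CommRing A] (n : ℕ) (I : Ideal A) : Type _ :=
  {ω : (Fin n → A) →ₗ[A] I.Cotangent // Function.Surjective ω}

/-- `𝓛𝓞(A, n)`: the pairs `(I, ω)` of an ideal `I` and a surjection `ω : Aⁿ → I/I²`. -/
def LO (A : Type*) [CommRing A] (n : ℕ) : Type _ :=
  Σ I : Ideal A, Orientation n I

/-- `V(I)` is connected (in particular non-empty) and `height I ≥ n`. -/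
def IsAdmissible {A : Type*} [CommRing A] (n : ℕ) (I : Ideal A) : Prop :=
  IsConnected (PrimeSpectrum.zeroLocus (I : Set A)) ∧ (n : ℕ∞) ≤ I.height

/-- `𝓛𝓞ᶜ(A, n)`: the pairs `(I, ω)` with `V(I)` connected and `height I ≥ n`. -/
def LOc (A : Type*) [CommRing A] (n : ℕ) : Type _ :=
  {x : LO A n // IsAdmissible n x.1}

/-- `(I, ω)` is global: `ω` lifts to a surjective map `Aⁿ → I`. -/
def IsGlobal {A : Type*} [CommRing A] {n : ℕ} (x : LO A n) : Prop :=
  ∃ f : (Fin n → A) →ₗ[A] x.1, Function.Surjective f ∧ x.1.toCotangent ∘ₗ f = x.2.1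

/-- `(J, ω_J)` is the orientation induced by `(I, ω_I)`: here `I ⊆ J`, and `ω_J` is the composite
of `ω_I` with the map `I/I² → J/J²` induced by the inclusion. -/
def IsInducedBy {A : Type*} [CommRing A] {n : ℕ} (y x : LO A n) : Prop :=
  ∃ h : x.1 ≤ y.1, y.2.1 = (Ideal.mapCotangent x.1 y.1 (AlgHom.id A A) h) ∘ₗ x.2.1

/-- The family `(I_i, ω_i)`, `i < m`, is the decomposition of `(I, ω)` into connected pieces:
the `I_i` are pairwise comaximal, every `V(I_i)` is connected, `I = ⋂ I_i`, and `ω_i` is induced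
by `ω`. (Such a family is unique up to order.) -/
structure IsDecomposition {A : Type*} [CommRing A] {n m : ℕ} (x : LO A n)
    (F : Fin m → LOc A n) : Prop where
  comaximal : ∀ i j, i ≠ j → (F i).1.1 ⊔ (F j).1.1 = ⊤
  iInf_eq : ⨅ i, (F i).1.1 = x.1
  induced : ∀ i, IsInducedBy (F i).1 x

/-- `EL_n(A)`: the subgroup of `GL_n(A)` generated by the elementary matrices. -/
def elementaryGroup (n : ℕ) (A : Type*) [CommRing A] : Subgroup (GL (Fin n) A) :=
  Subgroup.closure {g | ∃ (i j : Fin n) (c : A), i ≠ j ∧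
    (g : Matrix (Fin n) (Fin n) A) = Matrix.transvection i j c}

/-- `ω' = ω σ` for some `σ ∈ EL_n(A)`. -/
def elementarySetoid {A : Type*} [CommRing A] (n : ℕ) (I : Ideal A) :
    Setoid (Orientation n I) where
  r ω ω' := ∃ σ ∈ elementaryGroup n A,
    ω'.1 = ω.1 ∘ₗ Matrix.toLin' (σ : Matrix (Fin n) (Fin n) A)
  iseqv :=
    { refl := fun ω => ⟨1, one_mem _, by simp⟩
      symm := by
        rintro ω ω' ⟨σ, hσ, h⟩
        refine ⟨σ⁻¹, inv_mem hσ, ?_⟩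
        rw [h, LinearMap.comp_assoc, ← Matrix.toLin'_mul, ← Units.val_mul, mul_inv_cancel]
        simp
      trans := by
        rintro ω ω' ω'' ⟨σ, hσ, h⟩ ⟨τ, hτ, h'⟩
        refine ⟨σ * τ, mul_mem hσ hτ, ?_⟩
        rw [h', h, LinearMap.comp_assoc, ← Matrix.toLin'_mul, ← Units.val_mul] }

/-- `𝓛𝓞₀ᶜ(A, n)`: the pairs `(I, [ω])`, where `[ω]` is the class of a surjection `Aⁿ → I/I²`
modulo `EL_n(A)`, with `V(I)` connected and `height I ≥ n`. -/
def LOc₀ (A : Type*) [CommRing A] (n : ℕ) : Type _ :=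
  {x : Σ I : Ideal A, Quotient (elementarySetoid n I) // IsAdmissible n x.1}

/-- `(I, ω) ↦ (I, [ω])`. -/
def toLOc₀ {A : Type*} [CommRing A] {n : ℕ} (x : LOc A n) : LOc₀ A n :=
  ⟨⟨x.1.1, Quotient.mk (elementarySetoid n x.1.1) x.1.2⟩, x.2⟩

/-- The subgroup of `ℤ(𝓛𝓞ᶜ(A, n))` generated by the `ε(I, ω) = ∑ (I_i, ω_i)`, where `(I, ω)` is
global, `height I ≥ n`, and the `(I_i, ω_i)` form the decomposition of `(I, ω)`. -/
def relations (A : Type*) [CommRing A] (n : ℕ) : AddSubgroup (FreeAbelianGroup (LOc A n)) :=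
  AddSubgroup.closure {z | ∃ (x : LO A n) (m : ℕ) (F : Fin m → LOc A n),
    IsGlobal x ∧ (n : ℕ∞) ≤ x.1.height ∧ IsDecomposition x F ∧
      z = ∑ i, FreeAbelianGroup.of (F i)}

/-- The subgroup of `ℤ(𝓛𝓞₀ᶜ(A, n))` generated by the `ε₀(I, ω) = ∑ (I_i, [ω_i])`, where `(I, ω)`
is global, `height I ≥ n`, and the `(I_i, ω_i)` form the decomposition of `(I, ω)`. -/
def relations₀ (A : Type*) [CommRing A] (n : ℕ) : AddSubgroup (FreeAbelianGroup (LOc₀ A n)) :=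
  AddSubgroup.closure {z | ∃ (x : LO A n) (m : ℕ) (F : Fin m → LOc A n),
    IsGlobal x ∧ (n : ℕ∞) ≤ x.1.height ∧ IsDecomposition x F ∧
      z = ∑ i, FreeAbelianGroup.of (toLOc₀ (F i))}

/-- The modified Euler class group `Eⁿ(A)`. -/
abbrev E (A : Type*) [CommRing A] (n : ℕ) : Type _ :=
  FreeAbelianGroup (LOc A n) ⧸ relations A n

/-- The Euler class group `𝓔ⁿ(A)` of Bhatwadekar and Sridharan. -/
abbrev E₀ (A : Type*) [CommRing A] (n : ℕ) : Type _ :=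
  FreeAbelianGroup (LOc₀ A n) ⧸ relations₀ A n

/-- The homomorphism `φ : ℤ(𝓛𝓞ᶜ(A, n)) → ℤ(𝓛𝓞₀ᶜ(A, n))`, `(I, ω) ↦ (I, [ω])`. -/
def phi (A : Type*) [CommRing A] (n : ℕ) :
    FreeAbelianGroup (LOc A n) →+ FreeAbelianGroup (LOc₀ A n) :=
  FreeAbelianGroup.map toLOc₀

end EulerClass

namespace EulerClass

/-! ### Prime avoidance and general position. -/

section GeneralPosition

variable {A : Type*} [CommRing A]

/-! Everything reduces to showing that `(I, ω)` and `(I, ωσ)` agree in `E A n` for `σ` elementary;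
then `(I, [ω]) ↦ (I, ω)` inverts `Φ`.

By `exists_complement`, `(I, ω)` is the restriction to `I` of a global orientation of some `I ∩ J`,
with `J` comaximal to `I` and of height at least `n`. For a transvection `σ` with entry `c`, choose
`b ≡ c` mod `I` and `b ≡ 0` mod `J`. The transvection with entry `b` keeps the orientation of `I ∩
J` global, acts as `σ` on `I/I²` and trivially on `J/J²`. Subtracting the two relations cancels the
contribution of `J` (`of_sub_of_act_transvection_mem`).

The complement comes from Nakayama together with a general position argument;
`exists_isDecomposition` turns it into relations. -/

theorem le_height_of_forall_isPrime {I : Ideal A} {n : ℕ∞}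
    (h : ∀ p : Ideal A, p.IsPrime → I ≤ p → n ≤ p.height) : n ≤ I.height := by
  rw [Ideal.height_eq_inf_minimalPrimes]
  exact le_iInf₂ fun p hp => h p hp.1.1 hp.1.2

theorem le_height_inf {I J : Ideal A} {n : ℕ∞} (hI : n ≤ I.height) (hJ : n ≤ J.height) :
    n ≤ (I ⊓ J).height := by
  refine le_height_of_forall_isPrime fun p hp h => ?_
  rcases (hp.inf_le).1 h with h | h
  · exact hI.trans (Ideal.height_mono h)
  · exact hJ.trans (Ideal.height_mono h)

/-- Given finitely many pairwise incomparable primes not containing `e`, some element of the coset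
`f + eA` avoids all of them. -/
theorem exists_add_mul_notMem (S : Finset (Ideal A)) (hS : ∀ p ∈ S, p.IsPrime)
    (hanti : IsAntichain (· ≤ ·) (S : Set (Ideal A))) (f e : A) (he : ∀ p ∈ S, e ∉ p) :
    ∃ a : A, ∀ p ∈ S, f + a * e ∉ p := by
  classical
  -- Seek `a` inside every prime that misses `f` and outside every prime that contains `f`;
  -- incomparability makes prime avoidance applicable. The two `⊥` below fill the slots for
  -- non-prime exceptions, which are not needed.
  have key : ¬ (((S.filter (f ∉ ·)).inf id : Ideal A) : Set A) ⊆
      ⋃ p ∈ ((S.filter (f ∈ ·) : Finset (Ideal A)) : Set (Ideal A)), ((p : Ideal A) : Set A) := by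
    rw [Ideal.subset_union_prime (f := fun p => p) ⊥ ⊥ fun p hp _ _ => hS p (Finset.mem_filter.1 hp).1]
    rintro ⟨p, hp, hle⟩
    rw [Finset.mem_filter] at hp
    obtain ⟨q, hq, hqp⟩ := ((hS p hp.1).inf_le').1 hle
    rw [Finset.mem_filter] at hq
    have hqp' : q = p := hanti.eq hq.1 hp.1 hqp
    exact hq.2 (hqp' ▸ hp.2)
  obtain ⟨a, ha, ha'⟩ := Set.not_subset.1 key
  refine ⟨a, fun p hp hmem => ?_⟩
  by_cases hf : f ∈ p
  · have : a * e ∈ p := (Ideal.add_mem_iff_right p hf).1 hmem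
    rcases (hS p hp).mem_or_mem this with h | h
    · exact ha' (Set.mem_biUnion (Finset.mem_coe.2 (Finset.mem_filter.2 ⟨hp, hf⟩)) h)
    · exact he p hp h
  · have hle : (S.filter (f ∉ ·)).inf id ≤ p :=
      Finset.inf_le (f := id) (Finset.mem_filter.2 ⟨hp, hf⟩)
    exact hf ((Ideal.add_mem_iff_left p (p.mul_mem_right e (hle ha))).1 hmem)

/-- General position: after adding multiples of `e` to `f₁, …, fₙ`, every prime containing all of
them but not `e` has height at least `n`. -/
theorem exists_add_mul_height [IsNoetherianRing A] (e : A) :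
    ∀ (n : ℕ) (f : Fin n → A), ∃ a : Fin n → A, ∀ p : Ideal A, p.IsPrime → e ∉ p →
      (∀ i, f i + a i * e ∈ p) → (n : ℕ∞) ≤ p.height := by
  intro n
  induction n with
  | zero => exact fun f => ⟨0, fun p _ _ _ => by simp⟩
  | succ n ih =>
    intro f
    obtain ⟨a, ha⟩ := ih fun i => f i.castSucc
    set I : Ideal A := Ideal.span (Set.range fun i => f i.castSucc + a i * e) with hI
    have hfin : {q ∈ I.minimalPrimes | e ∉ q}.Finite :=
      (I.finite_minimalPrimes_of_isNoetherianRing A).subset fun q hq => hq.1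
    obtain ⟨b, hb⟩ := exists_add_mul_notMem hfin.toFinset
      (fun p hp => (hfin.mem_toFinset.1 hp).1.1.1)
      (by
        intro p hp q hq hne hle
        rw [Finset.mem_coe, hfin.mem_toFinset] at hp hq
        exact hne (le_antisymm hle (hq.1.2 hp.1.1 hle)))
      (f (Fin.last n)) e (fun p hp => (hfin.mem_toFinset.1 hp).2)
    refine ⟨Fin.snoc a b, fun p hp hep hmem => ?_⟩
    have hIp : I ≤ p := by
      rw [hI, Ideal.span_le]
      rintro _ ⟨i, rfl⟩
      simpa using hmem i.castSucc
    obtain ⟨q, hq, hqp⟩ := Ideal.exists_minimalPrimes_le hIp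
    have heq : e ∉ q := fun h => hep (hqp h)
    have hq' := hb q (hfin.mem_toFinset.2 ⟨hq, heq⟩)
    have hlast : f (Fin.last n) + b * e ∈ p := by simpa using hmem (Fin.last n)
    -- The last element lies in `p` but not in `q`, so the height grows by at least one.
    have hlt : q < p := lt_of_le_of_ne hqp fun h => hq' (h ▸ hlast)
    have := hq.1.1
    have hqn := ha q hq.1.1 heq fun i => hq.1.2 (Ideal.subset_span ⟨i, rfl⟩)
    have := Ideal.height_add_one_le_of_lt_of_isPrime hlt
    push_cast
    exact (add_le_add_left hqn 1).trans this

end GeneralPosition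

/-! ### Decomposition into connected pieces. -/

section Decomposition

variable {A : Type*} [CommRing A]

/-- A separation of `V(J)` by `V(K)` and `V(L)` determines `J` only up to radical. Adding high
powers of `K` and `L` to `J` recovers `J` itself as the intersection. -/
theorem exists_inf_eq_of_not_isConnected [IsNoetherianRing A] {J : Ideal A} (hJ : J ≠ ⊤)
    (hc : ¬ IsConnected (PrimeSpectrum.zeroLocus (J : Set A))) :
    ∃ J₁ J₂ : Ideal A, J < J₁ ∧ J < J₂ ∧ J₁ ⊔ J₂ = ⊤ ∧ J₁ ⊓ J₂ = J := by
  have hne : (PrimeSpectrum.zeroLocus (J : Set A)).Nonempty := by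
    rw [Set.nonempty_iff_ne_empty, Ne, PrimeSpectrum.zeroLocus_empty_iff_eq_top]
    exact hJ
  have hpre : ¬ IsPreconnected (PrimeSpectrum.zeroLocus (J : Set A)) := fun h => hc ⟨hne, h⟩
  rw [isPreconnected_iff_subset_of_fully_disjoint_closed (PrimeSpectrum.isClosed_zeroLocus _)]
    at hpre
  push Not at hpre
  obtain ⟨u, v, hu, hv, hsub, hdisj, hnu, hnv⟩ := hpre
  obtain ⟨K, rfl⟩ := (PrimeSpectrum.isClosed_iff_zeroLocus_ideal _).1 hu
  obtain ⟨L, rfl⟩ := (PrimeSpectrum.isClosed_iff_zeroLocus_ideal _).1 hv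
  have hKL : K ⊔ L = ⊤ := by
    rw [← PrimeSpectrum.zeroLocus_empty_iff_eq_top, PrimeSpectrum.zeroLocus_sup]
    exact hdisj.inter_eq
  have hrad : K * L ≤ J.radical := by
    rw [← PrimeSpectrum.zeroLocus_subset_zeroLocus_iff, PrimeSpectrum.zeroLocus_mul]
    exact hsub
  obtain ⟨N, hN⟩ := Ideal.exists_pow_le_of_le_radical_of_fg hrad (IsNoetherian.noetherian _)
  have hcop : K ^ N ⊔ L ^ N = ⊤ := Ideal.pow_sup_pow_eq_top hKL
  have hcop' : (J ⊔ K ^ N) ⊔ (J ⊔ L ^ N) = ⊤ :=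
    top_le_iff.1 (hcop ▸ sup_le_sup le_sup_right le_sup_right)
  have hzl : ∀ M : Ideal A, M ^ N ≤ J →
      PrimeSpectrum.zeroLocus (J : Set A) ⊆ PrimeSpectrum.zeroLocus (M : Set A) := by
    intro M hM p hp
    exact Ideal.IsPrime.le_of_pow_le (n := N) (hM.trans hp)
  refine ⟨J ⊔ K ^ N, J ⊔ L ^ N, ?_, ?_, hcop', ?_⟩
  · exact lt_of_le_of_ne le_sup_left fun h => hnu (hzl K (le_sup_right.trans h.ge))
  · exact lt_of_le_of_ne le_sup_left fun h => hnv (hzl L (le_sup_right.trans h.ge))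
  · refine le_antisymm ?_ (le_inf le_sup_left le_sup_left)
    rw [← Ideal.mul_eq_inf_of_isCoprime (Ideal.isCoprime_iff_sup_eq.2 hcop')]
    rw [Ideal.sup_mul, Ideal.mul_sup (K ^ N), ← mul_pow]
    exact sup_le (Ideal.mul_le_inf.trans inf_le_left)
      (sup_le (Ideal.mul_le_inf.trans inf_le_right) hN)

/-- Every ideal of a noetherian ring is a finite intersection of pairwise comaximal ideals with
connected zero loci. -/
theorem exists_connected_decomposition [IsNoetherianRing A] (J : Ideal A) :
    ∃ (ι : Type) (_ : Finite ι) (F : ι → Ideal A),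
      (∀ i j, i ≠ j → F i ⊔ F j = ⊤) ∧ ⨅ i, F i = J ∧
        ∀ i, IsConnected (PrimeSpectrum.zeroLocus (F i : Set A)) := by
  induction J using IsNoetherian.induction with
  | hgt J ih =>
    by_cases hJ : J = ⊤
    · exact ⟨Empty, inferInstance, Empty.elim, fun i => i.elim, by simp [hJ], fun i => i.elim⟩
    by_cases hc : IsConnected (PrimeSpectrum.zeroLocus (J : Set A))
    · exact ⟨Unit, inferInstance, fun _ => J, fun i j h => (h rfl).elim, by simp, fun _ => hc⟩
    obtain ⟨J₁, J₂, h₁, h₂, hsup, hinf⟩ := exists_inf_eq_of_not_isConnected hJ hc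
    obtain ⟨ι₁, _, F₁, hF₁, hi₁, hc₁⟩ := ih J₁ h₁
    obtain ⟨ι₂, _, F₂, hF₂, hi₂, hc₂⟩ := ih J₂ h₂
    have hle : ∀ i j, F₁ i ⊔ F₂ j = ⊤ := fun i j => top_le_iff.1 <| hsup ▸
      sup_le_sup (hi₁ ▸ iInf_le F₁ i) (hi₂ ▸ iInf_le F₂ j)
    refine ⟨ι₁ ⊕ ι₂, inferInstance, Sum.elim F₁ F₂, ?_, ?_, ?_⟩
    · rintro (i | i) (j | j) h
      · exact hF₁ i j fun e => h (e ▸ rfl)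
      · exact hle i j
      · exact sup_comm (F₁ j) (F₂ i) ▸ hle j i
      · exact hF₂ i j fun e => h (e ▸ rfl)
    · rw [iInf_sum, ← hinf, ← hi₁, ← hi₂]
      rfl
    · rintro (i | i)
      · exact hc₁ i
      · exact hc₂ i

theorem mapCotangent_surjective {I J : Ideal A} (h : I ≤ J) (hJ : J ≤ I ⊔ J ^ 2) :
    Function.Surjective (Ideal.mapCotangent I J (AlgHom.id A A) h) := by
  intro y
  obtain ⟨⟨y, hy⟩, rfl⟩ := J.toCotangent_surjective y
  obtain ⟨a, ha, b, hb, hab⟩ := Submodule.mem_sup.1 (hJ hy)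
  refine ⟨I.toCotangent ⟨a, ha⟩, ?_⟩
  refine (Ideal.toCotangent_eq (x := ⟨a, h ha⟩) (y := ⟨y, hy⟩)).2 ?_
  have : a - y = -b := by rw [← hab]; ring
  simpa only [this] using neg_mem hb

theorem le_inf_sup_sq {I J : Ideal A} (h : I ⊔ J = ⊤) : J ≤ I ⊓ J ⊔ J ^ 2 := by
  calc J = J * (I ⊔ J) := by rw [h, Ideal.mul_top]
    _ = J * I ⊔ J ^ 2 := by rw [Ideal.mul_sup, sq]
    _ ≤ I ⊓ J ⊔ J ^ 2 := sup_le_sup_right (Ideal.mul_le_inf.trans (inf_comm J I).le) _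

theorem IsInducedBy.trans {n : ℕ} {x y z : LO A n} (hzy : IsInducedBy z y)
    (hyx : IsInducedBy y x) : IsInducedBy z x := by
  obtain ⟨h, e⟩ := hzy
  obtain ⟨h', e'⟩ := hyx
  refine ⟨h'.trans h, ?_⟩
  rw [e, e', ← LinearMap.comp_assoc]
  congr 1
  ext w
  obtain ⟨w, rfl⟩ := x.1.toCotangent_surjective w
  rfl

/-- Every `(I, ω)` with `height I ≥ n` decomposes into connected pieces. -/
theorem exists_isDecomposition [IsNoetherianRing A] {n : ℕ} (x : LO A n)
    (hx : (n : ℕ∞) ≤ x.1.height) :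
    ∃ (m : ℕ) (F : Fin m → LOc A n), IsDecomposition x F := by
  obtain ⟨ι, _, F, hF, hi, hc⟩ := exists_connected_decomposition x.1
  obtain ⟨m, ⟨s⟩⟩ := Finite.exists_equiv_fin ι
  have hle : ∀ i, x.1 ≤ F i := fun i => hi ▸ iInf_le F i
  have hsurj : ∀ i, Function.Surjective
      (Ideal.mapCotangent x.1 (F i) (AlgHom.id A A) (hle i)) := by
    intro i
    refine mapCotangent_surjective _ ?_
    have : Fintype ι := Fintype.ofFinite ι
    classical
    have htop : (⨅ j ∈ Finset.univ.erase i, F j) ⊔ F i = ⊤ :=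
      Ideal.iInf_sup_eq_top fun j hj => hF j i (Finset.ne_of_mem_erase hj)
    refine (le_inf_sup_sq htop).trans (sup_le_sup_right ?_ _)
    rw [← hi]
    refine le_iInf fun j => ?_
    by_cases hji : j = i
    · exact hji ▸ inf_le_right
    · exact inf_le_left.trans (iInf₂_le j (Finset.mem_erase.2 ⟨hji, Finset.mem_univ j⟩))
  refine ⟨m, fun k => ⟨⟨F (s.symm k), ⟨(Ideal.mapCotangent x.1 (F (s.symm k)) (AlgHom.id A A) (hle (s.symm k))) ∘ₗ x.2.1,
    (hsurj (s.symm k)).comp x.2.2⟩⟩, hc _,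
    hx.trans (Ideal.height_mono (hle _))⟩, ?_, ?_, ?_⟩
  · exact fun i j hij => hF _ _ (s.symm.injective.ne hij)
  · exact (s.symm.iInf_comp (g := F)).trans hi
  · exact fun i => ⟨hle _, rfl⟩

/-- Applied with `y` on `I` and `z` on its complement, so that `y` appears as a single term of a
relation. -/
theorem IsDecomposition.cons {n m : ℕ} {x z : LO A n} {y : LOc A n} {F : Fin m → LOc A n}
    (hF : IsDecomposition z F) (hyx : IsInducedBy y.1 x) (hzx : IsInducedBy z x)
    (hsup : y.1.1 ⊔ z.1 = ⊤) (hinf : y.1.1 ⊓ z.1 = x.1) :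
    IsDecomposition x (Fin.cons y F : Fin (m + 1) → LOc A n) := by
  have hle : ∀ j, y.1.1 ⊔ (F j).1.1 = ⊤ := fun j =>
    top_le_iff.1 (hsup ▸ sup_le_sup_left (hF.iInf_eq ▸ iInf_le (fun i => (F i).1.1) j) _)
  refine ⟨?_, ?_, ?_⟩
  · intro i j
    refine Fin.cases ?_ (fun i => ?_) i <;> refine Fin.cases ?_ (fun j => ?_) j
    · exact fun h => (h rfl).elim
    · exact fun _ => hle j
    · exact fun _ => (sup_comm _ _).trans (hle i)
    · exact fun h => hF.comaximal i j fun e => h (e ▸ rfl)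
  · rw [← hinf, ← hF.iInf_eq]
    refine le_antisymm (le_inf (iInf_le _ 0) (le_iInf fun i => iInf_le _ i.succ)) (le_iInf fun i => ?_)
    refine Fin.cases ?_ (fun i => ?_) i
    · exact inf_le_left
    · exact inf_le_right.trans (iInf_le (fun i => (F i).1.1) i)
  · intro i
    refine Fin.cases ?_ (fun i => ?_) i
    · exact hyx
    · exact (hF.induced i).trans hzx

end Decomposition

/-! ### The moving lemma. -/

section Moving

variable {A : Type*} [CommRing A]

/-- Nakayama applied to `I = im f + I²`. -/
theorem exists_sub_one_mem_of_toCotangent_surjective [IsNoetherianRing A] {n : ℕ} {I : Ideal A}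
    (f : (Fin n → A) →ₗ[A] I) (hf : Function.Surjective (I.toCotangent ∘ₗ f)) :
    ∃ r : A, r - 1 ∈ I ∧ ∀ x ∈ I, ∃ v, (f v : A) = r * x := by
  have hle : I ≤ (LinearMap.range f).map I.subtype ⊔ I • I := by
    intro x hx
    obtain ⟨v, hv⟩ := hf (I.toCotangent ⟨x, hx⟩)
    have hmem : (x - f v : A) ∈ I ^ 2 := (Ideal.toCotangent_eq (x := ⟨x, hx⟩) (y := f v)).1 hv.symm
    refine Submodule.mem_sup.2 ⟨f v, ⟨f v, ⟨v, rfl⟩, rfl⟩, x - f v, ?_, by ring⟩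
    rwa [smul_eq_mul, ← sq]
  obtain ⟨r, hr, hrI⟩ := Submodule.exists_sub_one_mem_and_smul_le_of_fg_of_le_sup
    (IsNoetherian.noetherian I) le_rfl hle
  refine ⟨r, hr, fun x hx => ?_⟩
  obtain ⟨_, ⟨v, rfl⟩, hv⟩ := hrI (Submodule.smul_mem_pointwise_smul x r I hx)
  exact ⟨v, hv⟩

theorem exists_lift_general_position [IsNoetherianRing A] {n : ℕ} {I : Ideal A}
    (ω : (Fin n → A) →ₗ[A] I.Cotangent) (hω : Function.Surjective ω) :
    ∃ f : (Fin n → A) →ₗ[A] I, I.toCotangent ∘ₗ f = ω ∧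
      ∀ p : Ideal A, p.IsPrime → (∀ v, (f v : A) ∈ p) → ¬ I ≤ p → (n : ℕ∞) ≤ p.height := by
  obtain ⟨f₀, hf₀⟩ := Module.projective_lifting_property I.toCotangent ω I.toCotangent_surjective
  obtain ⟨r, hr, hrI⟩ := exists_sub_one_mem_of_toCotangent_surjective f₀ (hf₀ ▸ hω)
  -- The square puts `e` in `I²`, so adding multiples of `e` does not change the map to `I/I²`.
  set e : A := (r - 1) ^ 2 with he
  have heI2 : e ∈ I ^ 2 := Ideal.pow_mem_pow hr 2
  have heI : e ∈ I := Ideal.pow_le_self two_ne_zero heI2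
  obtain ⟨a, ha⟩ := exists_add_mul_height e n fun i => (f₀ (Pi.single i 1) : A)
  refine ⟨f₀ + (Fintype.linearCombination A a).smulRight ⟨e, heI⟩, ?_, ?_⟩
  · rw [LinearMap.comp_add, hf₀, add_eq_left]
    have : I.toCotangent ⟨e, heI⟩ = 0 := (Ideal.toCotangent_eq_zero I _).2 heI2
    refine LinearMap.ext fun v => ?_
    rw [LinearMap.comp_apply, LinearMap.smulRight_apply, map_smul, this, smul_zero,
      LinearMap.zero_apply]
  · intro p hp hfp hIp
    have hval : ∀ v, (f₀ v : A) + Fintype.linearCombination A a v * e ∈ p := hfp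
    refine ha p hp (fun hep => hIp fun x hx => ?_) fun i => ?_
    · obtain ⟨v, hv⟩ := hrI x hx
      have h₀ : r * x ∈ p := hv ▸ (Ideal.add_mem_iff_left p (p.mul_mem_left _ hep)).1 (hval v)
      -- Since `(r - 1)² + (2 - r) r = 1`, a prime containing `e` and the image of the perturbed
      -- lift contains `I`.
      have hx' : x = e * x + (2 - r) * (r * x) := by rw [he]; ring
      rw [hx']
      exact p.add_mem (p.mul_mem_right _ hep) (p.mul_mem_left _ h₀)
    · simpa using hval (Pi.single i 1)

/-- Moving lemma: `(I, ω)` has a complement `(J, ω_J)` with `J` comaximal to `I` of height at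
least `n`, such that both are induced by a global orientation of `I ∩ J`. -/
theorem exists_complement [IsNoetherianRing A] {n : ℕ} (x : LO A n) :
    ∃ z w : LO A n, IsGlobal w ∧ IsInducedBy x w ∧ IsInducedBy z w ∧ x.1 ⊔ z.1 = ⊤ ∧
      x.1 ⊓ z.1 = w.1 ∧ (n : ℕ∞) ≤ z.1.height := by
  obtain ⟨I, ω, hω⟩ := x
  obtain ⟨f, rfl, hf⟩ := exists_lift_general_position ω hω
  obtain ⟨r, hr, hrI⟩ := exists_sub_one_mem_of_toCotangent_surjective f hω
  let N : Ideal A := LinearMap.range (I.subtype ∘ₗ f)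
  -- Adjoining `r ≡ 1` mod `I` makes `J` comaximal to `I`, while `rI ⊆ N` forces `I ∩ J = N`.
  let J : Ideal A := N ⊔ Ideal.span {r}
  have hfN : ∀ v, (f v : A) ∈ N := fun v => ⟨v, rfl⟩
  have hrJ : r ∈ J := (le_sup_right : _ ≤ J) (Ideal.mem_span_singleton_self r)
  have hfJ : ∀ v, (f v : A) ∈ J := fun v => (le_sup_left : N ≤ J) (hfN v)
  have hsup : I ⊔ J = ⊤ := by
    rw [Ideal.eq_top_iff_one]
    exact Submodule.mem_sup.2 ⟨-(r - 1), neg_mem hr, r, hrJ, by ring⟩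
  have hN : ∀ y ∈ I ⊓ J, ∃ v, (f v : A) = y := by
    rintro y ⟨hyI, hyJ⟩
    obtain ⟨_, ⟨v, rfl⟩, c, hc, hvc⟩ := Submodule.mem_sup.1 hyJ
    obtain ⟨b, rfl⟩ := Ideal.mem_span_singleton'.1 hc
    have hvc' : (f v : A) + b * r = y := hvc
    have hbr : b * r ∈ I := (Ideal.add_mem_iff_right I (f v).2).1 (hvc' ▸ hyI)
    have hb : b ∈ I := by
      have : b = b * r - b * (r - 1) := by ring
      rw [this]
      exact I.sub_mem hbr (I.mul_mem_left _ hr)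
    obtain ⟨u, hu⟩ := hrI b hb
    exact ⟨v + u, by rw [map_add, Submodule.coe_add, hu, ← hvc', mul_comm r b]⟩
  let g : (Fin n → A) →ₗ[A] ↥(I ⊓ J) :=
    (I.subtype ∘ₗ f).codRestrict (I ⊓ J) fun v => ⟨(f v).2, hfJ v⟩
  have hg : Function.Surjective g := fun y =>
    (hN y.1 y.2).imp fun v hv => Subtype.ext hv
  have hgω : Function.Surjective ((I ⊓ J).toCotangent ∘ₗ g) :=
    (I ⊓ J).toCotangent_surjective.comp hg
  refine ⟨⟨J, (Ideal.mapCotangent (I ⊓ J) J (AlgHom.id A A) inf_le_right) ∘ₗ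
    (I ⊓ J).toCotangent ∘ₗ g, (mapCotangent_surjective _ (le_inf_sup_sq hsup)).comp hgω⟩,
    ⟨I ⊓ J, _, hgω⟩, ⟨g, hg, rfl⟩, ⟨inf_le_left, ?_⟩, ⟨inf_le_right, rfl⟩, hsup, rfl, ?_⟩
  · rfl
  · refine le_height_of_forall_isPrime fun p hp hJp =>
      hf p hp (fun v => hJp (hfJ v)) fun hIp => hp.ne_top ?_
    exact top_le_iff.1 (hsup ▸ sup_le hIp hJp)

end Moving

/-! ### Elementary matrices act trivially on classes. -/

section Elementary

variable {A : Type*} [CommRing A] {n : ℕ}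

/-- The composite is affine in the entry `c`, which enters only through its action on `M`; for `M =
I/I²` only `c` mod `I` matters. -/
theorem comp_transvection_congr {M : Type*} [AddCommGroup M] [Module A M]
    (g : (Fin n → A) →ₗ[A] M) (i j : Fin n) {c c' : A} (h : ∀ m : M, c • m = c' • m) :
    g ∘ₗ Matrix.toLin' (Matrix.transvection i j c) =
      g ∘ₗ Matrix.toLin' (Matrix.transvection i j c') := by
  have key : ∀ c : A, g ∘ₗ Matrix.toLin' (Matrix.transvection i j c) =
      g + c • (g ∘ₗ Matrix.toLin' (Matrix.single i j (1 : A))) := by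
    intro c
    have : Matrix.single i j c = c • Matrix.single i j (1 : A) := by simp
    rw [Matrix.transvection, this, map_add, map_smul, Matrix.toLin'_one, LinearMap.comp_add,
      LinearMap.comp_id, LinearMap.comp_smul]
  rw [key, key]
  ext1 v
  ext1
  simp [h]

/-- The action of an invertible matrix on orientations. -/
def LO.act (x : LO A n) (σ : GL (Fin n) A) : LO A n :=
  ⟨x.1, x.2.1 ∘ₗ Matrix.toLin' (σ : Matrix (Fin n) (Fin n) A),
    x.2.2.comp (Matrix.GeneralLinearGroup.toLin σ).toLinearEquiv.surjective⟩

theorem IsGlobal.act {x : LO A n} (hx : IsGlobal x) (σ : GL (Fin n) A) : IsGlobal (x.act σ) := by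
  obtain ⟨f, hf, hfx⟩ := hx
  exact ⟨f ∘ₗ Matrix.toLin' (σ : Matrix (Fin n) (Fin n) A),
    hf.comp (Matrix.GeneralLinearGroup.toLin σ).toLinearEquiv.surjective,
    congrArg (· ∘ₗ Matrix.toLin' (σ : Matrix (Fin n) (Fin n) A)) hfx⟩

/-- The action of an invertible matrix on `𝓛𝓞ᶜ(A, n)`. -/
def LOc.act (x : LOc A n) (σ : GL (Fin n) A) : LOc A n :=
  ⟨x.1.act σ, x.2⟩

theorem LOc.act_mul (x : LOc A n) (σ τ : GL (Fin n) A) :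
    x.act (σ * τ) = (x.act σ).act τ := by
  obtain ⟨⟨I, ω, hω⟩, hx⟩ := x
  refine Subtype.ext (congrArg (Sigma.mk I) (Subtype.ext ?_))
  change ω ∘ₗ Matrix.toLin' ((σ * τ : GL (Fin n) A) : Matrix (Fin n) (Fin n) A) = _
  rw [Units.val_mul, Matrix.toLin'_mul, ← LinearMap.comp_assoc]
  rfl

theorem LOc.act_one (x : LOc A n) : x.act 1 = x := by
  obtain ⟨⟨I, ω, hω⟩, hx⟩ := x
  refine Subtype.ext (congrArg (Sigma.mk I) (Subtype.ext ?_))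
  change ω ∘ₗ Matrix.toLin' ((1 : GL (Fin n) A) : Matrix (Fin n) (Fin n) A) = ω
  rw [Units.val_one, Matrix.toLin'_one, LinearMap.comp_id]

theorem sum_mem_relations {x : LO A n} (hx : IsGlobal x) (hn : (n : ℕ∞) ≤ x.1.height) {m : ℕ}
    {F : Fin m → LOc A n} (hF : IsDecomposition x F) :
    ∑ i, FreeAbelianGroup.of (F i) ∈ relations A n :=
  AddSubgroup.subset_closure ⟨x, m, F, hx, hn, hF, rfl⟩

/-- Two orientations of `I` that differ by an elementary matrix have the same class in `Eⁿ(A)`. By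
the Chinese remainder theorem, the matrix can be chosen trivial on a complement `J` of `I`. -/
theorem of_sub_of_act_transvection_mem [IsNoetherianRing A] (x : LOc A n) {σ : GL (Fin n) A}
    {i j : Fin n} {c : A} (hij : i ≠ j)
    (hσ : (σ : Matrix (Fin n) (Fin n) A) = Matrix.transvection i j c) :
    FreeAbelianGroup.of x - FreeAbelianGroup.of (x.act σ) ∈ relations A n := by
  obtain ⟨z, w, hw, ⟨hwx, exw⟩, ⟨hwz, ezw⟩, hsup, hinf, hz⟩ := exists_complement x.1
  obtain ⟨m, F, hF⟩ := exists_isDecomposition z hz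
  have hnw : (n : ℕ∞) ≤ w.1.height := hinf ▸ le_height_inf x.2.2 hz
  -- With `c = a + b`, the entry `b` is `c` modulo `I` and `0` modulo `J`.
  obtain ⟨a, ha, b, hb, hab⟩ := Submodule.mem_sup.1 (hsup.symm ▸ Submodule.mem_top : c ∈ x.1.1 ⊔ z.1)
  let τ : GL (Fin n) A := Matrix.GeneralLinearGroup.mk'' (Matrix.transvection i j b)
    (by rw [Matrix.det_transvection_of_ne i j hij]; exact isUnit_one)
  have hxτ : IsInducedBy (x.act σ).1 (w.act τ) := by
    refine ⟨hwx, ?_⟩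
    change x.1.2.1 ∘ₗ Matrix.toLin' (σ : Matrix (Fin n) (Fin n) A) = _
    rw [hσ, comp_transvection_congr x.1.2.1 i j (c' := b)
      fun y => by rw [← hab, add_smul, Ideal.Cotangent.smul_eq_zero_of_mem ha, zero_add]]
    exact congrArg (· ∘ₗ Matrix.toLin' (Matrix.transvection i j b)) exw
  have hzτ : IsInducedBy z (w.act τ) := by
    refine ⟨hwz, ?_⟩
    refine Eq.trans ?_ (congrArg (· ∘ₗ Matrix.toLin' (Matrix.transvection i j b)) ezw)
    rw [comp_transvection_congr z.2.1 i j (c := b) (c' := 0)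
      fun y => by rw [Ideal.Cotangent.smul_eq_zero_of_mem hb, zero_smul], Matrix.transvection_zero,
      Matrix.toLin'_one, LinearMap.comp_id]
  have h₁ := sum_mem_relations hw hnw (hF.cons ⟨hwx, exw⟩ ⟨hwz, ezw⟩ hsup hinf)
  have h₂ := sum_mem_relations (hw.act τ) hnw (hF.cons (y := x.act σ) hxτ hzτ hsup hinf)
  rw [Fin.sum_univ_succ] at h₁ h₂
  simpa using (relations A n).sub_mem h₁ h₂

theorem of_sub_of_act_mem [IsNoetherianRing A] {σ : GL (Fin n) A} (hσ : σ ∈ elementaryGroup n A) :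
    ∀ x : LOc A n, FreeAbelianGroup.of x - FreeAbelianGroup.of (x.act σ) ∈ relations A n := by
  induction hσ using Subgroup.closure_induction with
  | mem σ h =>
    obtain ⟨i, j, c, hij, h⟩ := h
    exact fun x => of_sub_of_act_transvection_mem x hij h
  | one => exact fun x => by rw [x.act_one, sub_self]; exact zero_mem _
  | mul σ τ _ _ hσ hτ =>
    intro x
    rw [x.act_mul, ← sub_add_sub_cancel _ (FreeAbelianGroup.of (x.act σ))]
    exact add_mem (hσ x) (hτ _)
  | inv σ _ hσ =>
    intro x
    have := hσ (x.act σ⁻¹)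
    rw [← LOc.act_mul, inv_mul_cancel, LOc.act_one] at this
    exact neg_sub (FreeAbelianGroup.of (x.act σ⁻¹)) _ ▸ neg_mem this

theorem exists_act_eq_of_toLOc₀_eq {x y : LOc A n} (h : toLOc₀ x = toLOc₀ y) :
    ∃ σ ∈ elementaryGroup n A, y = x.act σ := by
  obtain ⟨⟨I, ω⟩, hx⟩ := x
  obtain ⟨⟨J, ω'⟩, hy⟩ := y
  have h' := congrArg Subtype.val h
  obtain rfl : I = J := congrArg Sigma.fst h'
  obtain ⟨σ, hσ, e⟩ := Quotient.exact (eq_of_heq (Sigma.mk.inj h').2)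
  exact ⟨σ, hσ, Subtype.ext (congrArg (Sigma.mk I) (Subtype.ext e))⟩

theorem toLOc₀_surjective : Function.Surjective (toLOc₀ : LOc A n → LOc₀ A n) := by
  rintro ⟨⟨I, q⟩, h⟩
  induction q using Quotient.inductionOn with
  | _ ω => exact ⟨⟨⟨I, ω⟩, h⟩, rfl⟩

theorem phi_of (x : LOc A n) : phi A n (FreeAbelianGroup.of x) = FreeAbelianGroup.of (toLOc₀ x) :=
  FreeAbelianGroup.map_of_apply x

theorem relations_le_comap_phi : relations A n ≤ (relations₀ A n).comap (phi A n) := by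
  refine (AddSubgroup.closure_le _).2 ?_
  rintro _ ⟨x, m, F, hx, hn, hF, rfl⟩
  refine AddSubgroup.subset_closure ⟨x, m, F, hx, hn, hF, ?_⟩
  simp only [map_sum, phi_of]

theorem phi_surjective : Function.Surjective (phi A n) := by
  intro z
  induction z using FreeAbelianGroup.induction_on with
  | zero => exact ⟨0, map_zero _⟩
  | of y =>
    obtain ⟨x, rfl⟩ := toLOc₀_surjective y
    exact ⟨_, phi_of x⟩
  | neg y h =>
    obtain ⟨x, hx⟩ := h
    exact ⟨-x, by rw [map_neg, hx]⟩
  | add y z hy hz =>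
    obtain ⟨a, rfl⟩ := hy
    obtain ⟨b, rfl⟩ := hz
    exact ⟨a + b, map_add _ _ _⟩

/-- The map `ℤ(𝓛𝓞₀ᶜ(A, n)) → Eⁿ(A)` sending `(I, [ω])` to the class of `(I, ω)`. -/
noncomputable def toE (A : Type*) [CommRing A] (n : ℕ) : FreeAbelianGroup (LOc₀ A n) →+ E A n :=
  FreeAbelianGroup.lift fun y =>
    QuotientAddGroup.mk' (relations A n) (FreeAbelianGroup.of (toLOc₀_surjective y).choose)

/-- The representative chosen in `toE` differs from `x` by an elementary matrix, hence has the same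
class. -/
theorem toE_comp_phi [IsNoetherianRing A] :
    (toE A n).comp (phi A n) = QuotientAddGroup.mk' (relations A n) := by
  ext x
  obtain ⟨σ, hσ, e⟩ := exists_act_eq_of_toLOc₀_eq (toLOc₀_surjective (toLOc₀ x)).choose_spec.symm
  rw [AddMonoidHom.comp_apply, phi_of, toE, FreeAbelianGroup.lift_apply_of, e]
  refine (QuotientAddGroup.eq_iff_sub_mem.2 ?_).symm
  exact of_sub_of_act_mem hσ x

theorem relations₀_le_ker_toE [IsNoetherianRing A] : relations₀ A n ≤ (toE A n).ker := by
  refine (AddSubgroup.closure_le _).2 ?_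
  rintro _ ⟨x, m, F, hx, hn, hF, rfl⟩
  simp only [← phi_of, ← map_sum]
  change ((toE A n).comp (phi A n)) _ = 0
  rw [toE_comp_phi]
  exact (QuotientAddGroup.eq_zero_iff _).2 (sum_mem_relations hx hn hF)

end Elementary

end EulerClass

theorem mainTheorem12 (A : Type*) [CommRing A] [IsNoetherianRing A] (d n : ℕ)
    (hd : ringKrullDim A = (d : WithBot ℕ∞)) :
    ∃ Φ : EulerClass.E A n →+ EulerClass.E₀ A n,
      (∀ z : FreeAbelianGroup (EulerClass.LOc A n),
        Φ (QuotientAddGroup.mk' (EulerClass.relations A n) z) =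
          QuotientAddGroup.mk' (EulerClass.relations₀ A n) (EulerClass.phi A n z)) ∧
      Function.Surjective Φ ∧
      (d + 3 ≤ 2 * n → Function.Bijective Φ) := by
  have hsurj : Function.Surjective (QuotientAddGroup.map (EulerClass.relations A n)
      (EulerClass.relations₀ A n) (EulerClass.phi A n) EulerClass.relations_le_comap_phi) :=
    QuotientAddGroup.map_surjective_of_surjective _ _ _
      ((QuotientAddGroup.mk'_surjective _).comp EulerClass.phi_surjective) _
  refine ⟨_, fun z => rfl, hsurj, fun _ => ⟨?_, hsurj⟩⟩
  rw [injective_iff_map_eq_zero]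
  intro q hq
  obtain ⟨z, rfl⟩ := QuotientAddGroup.mk'_surjective _ q
  -- `toE` kills `relations₀`, and `toE ∘ phi` is the quotient map, so the class of `z` vanishes.
  have hz : EulerClass.toE A n (EulerClass.phi A n z) = 0 :=
    EulerClass.relations₀_le_ker_toE ((QuotientAddGroup.eq_zero_iff _).1 hq)
  rwa [← EulerClass.toE_comp_phi]
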